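/- Let $(A,\mathfrak m)$ be a Noetherian local ring of dimension $d>0$. Suppose that $A$ is sequentially Cohen--Macaulay, that is, there are $t>0$ and ideals $(0)=M_0\subsetneq M_1\subsetneq\cdots\subsetneq M_t=A$ such that, for all $1\le i\le t$, $\dim_A M_{i-1}<\dim_A M_i$ (where $\dim_A (0)=-\infty$) and $M_i/M_{i-1}$ is a Cohen--Macaulay $A$-module. If $\dim A/\mathfrak p\neq d-1$ for every $\mathfrak p\in\operatorname{Ass}(A)$, then $A$ is a Vasconcelos ring, that is, $e_1(Q)=0$ for some parameter ideal $Q$ of $A$. Here a parameter ideal is an ideal generated by $d$ elements whose radical is $\mathfrak m$, and $e_0(Q),\dots,e_d(Q)$ denote the Hilbert coefficients of $Q$, that is, the unique integers with $$\ell_A(A/Q^{n+1})=\sum_{i=0}^{d}(-1)^i e_i(Q)\binom{n+d-i}{d-i}\qquad\text{for all } n\gg 0 .$$ (In general a Noetherian local ring is called Vasconcelos if its dimension is $0$, or if its dimension is positive and $e_1(Q)=0$ for some parameter ideal $Q$.) -/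

import Mathlib

open IsLocalRing

/-- The depth of a finitely generated module `M` over a Noetherian local ring `A`: the supremum of
the lengths of `M`-regular sequences contained in the maximal ideal. -/
noncomputable def moduleDepth (A : Type*) [CommRing A] [IsLocalRing A]
    (M : Type*) [AddCommGroup M] [Module A M] : ℕ∞ :=
  ⨆ (rs : List A) (_ : (∀ r ∈ rs, r ∈ maximalIdeal A) ∧ RingTheory.Sequence.IsRegular M rs),
    (rs.length : ℕ∞)

/-- A finitely generated module `M` over a Noetherian local ring is Cohen–Macaulay if `M = 0` or
`depth M = dim M`. -/
def IsCohenMacaulayModule (A : Type*) [CommRing A] [IsLocalRing A]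
    (M : Type*) [AddCommGroup M] [Module A M] : Prop :=
  Module.Finite A M ∧
    (Subsingleton M ∨ ((moduleDepth A M : ℕ∞) : WithBot ℕ∞) = Module.supportDim A M)

/-- `M` is sequentially Cohen–Macaulay: it admits a Cohen–Macaulay filtration
`0 = N 0 ⊊ N 1 ⊊ ⋯ ⊊ N t = M` with `t > 0`, `dim N i < dim N (i+1)` and `N (i+1) / N i`
Cohen–Macaulay. Here `dim 0 = ⊥` is smaller than the dimension of any nonzero module. -/
def IsSequentiallyCohenMacaulayModule (A : Type*) [CommRing A] [IsLocalRing A]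
    (M : Type*) [AddCommGroup M] [Module A M] : Prop :=
  ∃ (t : ℕ) (N : ℕ → Submodule A M), 0 < t ∧ N 0 = ⊥ ∧ N t = ⊤ ∧
    ∀ i < t, N i < N (i + 1) ∧
      Module.supportDim A (N i) < Module.supportDim A (N (i + 1)) ∧
      IsCohenMacaulayModule A (N (i + 1) ⧸ (N i).submoduleOf (N (i + 1)))

/-- A local ring is sequentially Cohen–Macaulay if it is so as a module over itself. -/
def IsSequentiallyCohenMacaulayRing (A : Type*) [CommRing A] [IsLocalRing A] : Prop :=
  IsSequentiallyCohenMacaulayModule A A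

/-- `Q` is a parameter ideal of the local ring `A`: it is generated by `d = dim A` elements
and its radical is the maximal ideal. -/
def IsParameterIdeal {A : Type*} [CommRing A] [IsLocalRing A] (Q : Ideal A) : Prop :=
  ∃ (d : ℕ) (a : Fin d → A), ringKrullDim A = d ∧ Q = Ideal.span (Set.range a) ∧
    Q.radical = maximalIdeal A

/-- `e 0, …, e d` are the Hilbert coefficients of `A` (of dimension `d`) with respect to the
ideal `I` (primary to the maximal ideal): for all large `n`, `A / I ^ (n + 1)` has finite length
`∑ i ≤ d, (-1) ^ i * e i * binom (n + d - i) (d - i)`. These integers are uniquely determined;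
the values `e i` for `i > d` play no role. -/
def IsHilbertCoefficients {A : Type*} [CommRing A] (I : Ideal A) (d : ℕ) (e : ℕ → ℤ) : Prop :=
  ∀ᶠ n : ℕ in Filter.atTop, ∃ l : ℕ, Module.length A (A ⧸ I ^ (n + 1)) = l ∧
    (l : ℤ) = ∑ i ∈ Finset.range (d + 1),
      (-1) ^ i * e i * (((n + d - i).choose (d - i) : ℕ) : ℤ)

/-- A Noetherian local ring `A` is a Vasconcelos ring if `dim A = 0`, or `dim A > 0` and
`e₁(Q) = 0` for some parameter ideal `Q` of `A`. -/
def IsVasconcelosRing (A : Type*) [CommRing A] [IsLocalRing A] : Prop :=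
  ringKrullDim A = 0 ∨
    ∃ d : ℕ, 0 < d ∧ ringKrullDim A = d ∧
      ∃ Q : Ideal A, IsParameterIdeal Q ∧
        ∃ e : ℕ → ℤ, IsHilbertCoefficients Q d e ∧ e 1 = 0

/-! Let `I` be the last proper member of the filtration. Since `dim I < d`, a chain of primes of
length `d` must lie over `I`, so `A / I` is Cohen–Macaulay of dimension `d` and has a regular
sequence `rs` of length `d`. If `I ≠ 0`, its dimension is attained at a prime of `Ass I ⊆ Ass A`, so
it is not `d - 1`, and hence `dim I ≤ d - 2`.

By prime avoidance, `rs` can be changed modulo `I` to generate a parameter ideal `Q` of `A`. Then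
`ℓ(A / Q ^ (n + 1))` is the sum of `ℓ(A / (I + Q ^ (n + 1)))` and the length of the image of `I` in
`A / Q ^ (n + 1)`. As `Q` and `rs` agree modulo `I`, the first summand is exactly `e₀ * binom (n +
d) d`. The second is eventually a polynomial, being a difference of two such functions. It is at
most `ℓ(I / Q ^ (n + 1) I)`, so it grows at most like `n ^ (d - 2)`. Nothing is left in degree `d -
1`, that is, `e₁(Q) = 0`.

The ingredients are a Hilbert–Serre theorem, stated for pairs of filtrations instead of graded
modules, the Hilbert function of a regular sequence, and prime avoidance in cosets of `I`. -/

/-- `f : ℕ → ℤ` agrees for large `n` with an integral combination of the binomial polynomials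
`binom (n + j) j`, `j < D`; that is, with an integer-valued polynomial of degree `< D`. -/
def IsEventuallyBinomial (D : ℕ) (f : ℕ → ℤ) : Prop :=
  ∃ c : ℕ → ℤ, ∀ᶠ n : ℕ in Filter.atTop,
    f n = ∑ j ∈ Finset.range D, c j * (((n + j).choose j : ℕ) : ℤ)

/-! ### Eventually polynomial functions: summation and growth. -/

namespace IsEventuallyBinomial

variable {D : ℕ} {f g : ℕ → ℤ}

theorem of_eventually_eq_zero (h : ∀ᶠ n : ℕ in Filter.atTop, f n = 0) :
    IsEventuallyBinomial D f :=
  ⟨0, by filter_upwards [h] with n hn; simp [hn]⟩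

theorem mono {D' : ℕ} (hf : IsEventuallyBinomial D f) (h : D ≤ D') :
    IsEventuallyBinomial D' f := by
  obtain ⟨c, hc⟩ := hf
  refine ⟨fun j ↦ if j < D then c j else 0, ?_⟩
  filter_upwards [hc] with n hn
  rw [hn, ← Finset.sum_subset (Finset.range_subset_range.mpr h)]
  · exact Finset.sum_congr rfl fun j hj ↦ by rw [if_pos (Finset.mem_range.mp hj)]
  · intro j _ hj
    rw [if_neg (by simpa using hj), zero_mul]

theorem sub (hf : IsEventuallyBinomial D f) (hg : IsEventuallyBinomial D g) :
    IsEventuallyBinomial D (fun n ↦ f n - g n) := by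
  obtain ⟨c, hc⟩ := hf
  obtain ⟨c', hc'⟩ := hg
  refine ⟨fun j ↦ c j - c' j, ?_⟩
  filter_upwards [hc, hc'] with n h h'
  rw [h, h', ← Finset.sum_sub_distrib]
  exact Finset.sum_congr rfl fun j _ ↦ by ring

/-- Subtracting a multiple of the binomial polynomial of top degree. -/
theorem sub_choose (hf : IsEventuallyBinomial (D + 1) f) (a : ℤ) :
    IsEventuallyBinomial (D + 1) (fun n ↦ f n - a * (((n + D).choose D : ℕ) : ℤ)) := by
  refine hf.sub ⟨Pi.single D a, Filter.Eventually.of_forall fun n ↦ ?_⟩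
  rw [Finset.sum_eq_single D]
  · simp
  · intro j _ hj
    simp [Pi.single_eq_of_ne hj]
  · simp

theorem of_difference (h : IsEventuallyBinomial D (fun n ↦ f (n + 1) - f n)) :
    IsEventuallyBinomial (D + 1) f := by
  obtain ⟨c, hc⟩ := h
  obtain ⟨N, hN⟩ := Filter.eventually_atTop.mp hc
  let b : ℕ → ℕ → ℤ := fun j n ↦ (((n + j).choose j : ℕ) : ℤ)
  have hb (j n : ℕ) : b (j + 1) (n + 1) = b j (n + 1) + b (j + 1) n := by
    have : n + 1 + (j + 1) = (n + 1 + j) + 1 := by ring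
    simp only [b]
    rw [this, Nat.choose_succ_succ, show n + (j + 1) = n + 1 + j by ring]
    push_cast
    ring
  -- Pascal's rule makes the difference of `b (j + 1)` equal to `b j` at `n + 1`, not at `n`;
  -- subtracting `b j` corrects the shift.
  let G : ℕ → ℤ := fun n ↦ ∑ j ∈ Finset.range D, c j * (b (j + 1) n - b j n)
  have hG (n : ℕ) : G (n + 1) - G n = ∑ j ∈ Finset.range D, c j * b j n := by
    simp only [G]
    rw [← Finset.sum_sub_distrib]
    refine Finset.sum_congr rfl fun j _ ↦ ?_
    rw [hb]
    ring
  have hk (n : ℕ) (hn : N ≤ n) : f n = (f N - G N) + G n := by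
    induction n, hn using Nat.le_induction with
    | base => ring
    | succ n hn ih =>
      have h1 := hN n hn
      have h2 := hG n
      simp only [b] at h2
      linarith
  refine ⟨fun j ↦ (if j = 0 then f N - G N else c (j - 1)) - (if j < D then c j else 0),
    Filter.eventually_atTop.mpr ⟨N, fun n hn ↦ ?_⟩⟩
  rw [hk n hn]
  simp only [sub_mul, Finset.sum_sub_distrib]
  rw [Finset.sum_range_succ', Finset.sum_range_succ]
  have h1 : ∑ j ∈ Finset.range D, (if j < D then c j else 0) * (((n + j).choose j : ℕ) : ℤ) =
      ∑ j ∈ Finset.range D, c j * b j n :=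
    Finset.sum_congr rfl fun j hj ↦ by rw [if_pos (Finset.mem_range.mp hj)]
  rw [h1]
  simp [G, b, mul_sub, Finset.sum_sub_distrib]
  ring

theorem _root_.Nat.choose_add_self_le_pow (n j : ℕ) : (n + j).choose j ≤ (n + 1) ^ j := by
  induction j with
  | zero => simp
  | succ j ih =>
    have h := Nat.add_one_mul_choose_eq (n + j) j
    refine Nat.le_of_mul_le_mul_right (c := j + 1) ?_ (Nat.succ_pos j)
    calc (n + (j + 1)).choose (j + 1) * (j + 1) = (n + j + 1) * (n + j).choose j := h.symm
      _ ≤ ((n + 1) * (j + 1)) * (n + 1) ^ j := Nat.mul_le_mul (by nlinarith) ih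
      _ = (n + 1) ^ (j + 1) * (j + 1) := by ring

theorem sum_choose_le (D : ℕ) (c : ℕ → ℤ) (n : ℕ) :
    |∑ j ∈ Finset.range (D + 1), c j * (((n + j).choose j : ℕ) : ℤ)| ≤
      (∑ j ∈ Finset.range (D + 1), |c j|) * ((n : ℤ) + 1) ^ D := by
  refine (Finset.abs_sum_le_sum_abs _ _).trans ?_
  rw [Finset.sum_mul]
  refine Finset.sum_le_sum fun j hj ↦ ?_
  rw [abs_mul, Nat.abs_cast]
  refine mul_le_mul_of_nonneg_left ?_ (abs_nonneg _)
  calc (((n + j).choose j : ℕ) : ℤ) ≤ ((n : ℤ) + 1) ^ j := by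
        exact_mod_cast Nat.choose_add_self_le_pow n j
    _ ≤ ((n : ℤ) + 1) ^ D :=
        pow_le_pow_right₀ (by linarith [Int.natCast_nonneg n])
          (Nat.lt_succ_iff.mp (Finset.mem_range.mp hj))

theorem exists_le_pow (hf : IsEventuallyBinomial (D + 1) f) :
    ∃ K : ℤ, 0 ≤ K ∧ ∀ᶠ n : ℕ in Filter.atTop, |f n| ≤ K * ((n : ℤ) + 1) ^ D := by
  obtain ⟨c, hc⟩ := hf
  refine ⟨∑ j ∈ Finset.range (D + 1), |c j|, Finset.sum_nonneg fun _ _ ↦ abs_nonneg _, ?_⟩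
  filter_upwards [hc] with n hn
  rw [hn]
  exact sum_choose_le D c n

/-- If `f` grows at most like `n ^ D`, then its polynomial has degree at most `D`. -/
theorem of_le_pow {K : ℤ} (hf : IsEventuallyBinomial (D + 2) f)
    (hK : ∀ᶠ n : ℕ in Filter.atTop, |f n| ≤ K * ((n : ℤ) + 1) ^ D) :
    IsEventuallyBinomial (D + 1) f := by
  obtain ⟨c, hc⟩ := hf
  -- A nonzero top coefficient would give `binom (n + D + 1) (D + 1) ≤ K' (n + 1) ^ D`. This
  -- binomial is at least `(n + 1) ^ (D + 1) / (D + 1)!`, a contradiction once `n ≥ (D + 1)! K'`.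
  have hcD : c (D + 1) = 0 := by
    by_contra hne
    let K' : ℤ := K + ∑ j ∈ Finset.range (D + 1), |c j|
    obtain ⟨n, ⟨h1, h2⟩, h3⟩ := ((hc.and hK).and
      (Filter.eventually_ge_atTop (((D + 1).factorial * K').toNat))).exists
    rw [Finset.sum_range_succ] at h1
    have h4 := sum_choose_le D c n
    have h5 : (((n + (D + 1)).choose (D + 1) : ℕ) : ℤ) ≤ K' * ((n : ℤ) + 1) ^ D := by
      calc (((n + (D + 1)).choose (D + 1) : ℕ) : ℤ)
          ≤ |c (D + 1)| * (((n + (D + 1)).choose (D + 1) : ℕ) : ℤ) :=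
            le_mul_of_one_le_left (Int.natCast_nonneg _) (Int.one_le_abs hne)
        _ = |f n - ∑ j ∈ Finset.range (D + 1), c j * (((n + j).choose j : ℕ) : ℤ)| := by
            rw [h1, add_sub_cancel_left, abs_mul, Nat.abs_cast]
        _ ≤ _ := (abs_sub _ _).trans (by simp only [K']; linarith)
    have h6 : ((n : ℤ) + 1) ^ (D + 1) ≤
        (D + 1).factorial * (((n + (D + 1)).choose (D + 1) : ℕ) : ℤ) := by
      have h := Nat.pow_succ_le_ascFactorial (n + 1) (D + 1)
      rw [Nat.ascFactorial_eq_factorial_mul_choose] at h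
      exact_mod_cast h
    have hpos : (0 : ℤ) < ((n : ℤ) + 1) ^ D := by positivity
    have h7 : ((n : ℤ) + 1) * ((n : ℤ) + 1) ^ D ≤
        ((D + 1).factorial * K') * ((n : ℤ) + 1) ^ D := by
      calc ((n : ℤ) + 1) * ((n : ℤ) + 1) ^ D = ((n : ℤ) + 1) ^ (D + 1) := by ring
        _ ≤ _ := h6
        _ ≤ (D + 1).factorial * (K' * ((n : ℤ) + 1) ^ D) :=
          mul_le_mul_of_nonneg_left h5 (Int.natCast_nonneg _)
        _ = _ := by ring
    have h8 := le_of_mul_le_mul_right h7 hpos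
    have h9 := Int.toNat_le.mp h3
    linarith
  refine ⟨c, ?_⟩
  filter_upwards [hc] with n hn
  rw [hn, Finset.sum_range_succ, hcD, zero_mul, add_zero]

end IsEventuallyBinomial

/-! ### Additivity of colength. -/

section Length

variable {R M : Type*} [CommRing R] [AddCommGroup M] [Module R M]

theorem Submodule.length_quotient_anti {N K : Submodule R M} (h : K ≤ N) :
    Module.length R (M ⧸ N) ≤ Module.length R (M ⧸ K) :=
  Module.length_le_of_surjective (Submodule.factor h) (Submodule.factor_surjective h)

/-- Additivity of colength along `K ≤ N`. -/
theorem Submodule.length_quotient_eq_add_length_map {N K : Submodule R M} (h : K ≤ N) :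
    Module.length R (M ⧸ K) = Module.length R (N.map K.mkQ) + Module.length R (M ⧸ N) := by
  refine Module.length_eq_add_of_exact (N.map K.mkQ).subtype (Submodule.factor h)
    (Submodule.subtype_injective _) (Submodule.factor_surjective h) ?_
  rw [LinearMap.exact_iff, Submodule.range_subtype]
  ext x
  obtain ⟨x, rfl⟩ := K.mkQ_surjective x
  rw [LinearMap.mem_ker, Submodule.mkQ_apply, show Submodule.factor h (Submodule.Quotient.mk x) =
    Submodule.Quotient.mk x from rfl, Submodule.Quotient.mk_eq_zero, Submodule.mem_map]
  constructor
  · exact fun hx ↦ ⟨x, hx, rfl⟩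
  · rintro ⟨y, hy, hyx⟩
    have := h ((Submodule.Quotient.eq K).mp hyx)
    simpa using N.sub_mem hy this

theorem LinearMap.length_range_eq_of_ker_eq {N P P' : Type*} [AddCommGroup N] [Module R N]
    [AddCommGroup P] [Module R P] [AddCommGroup P'] [Module R P']
    (f : N →ₗ[R] P) (g : N →ₗ[R] P') (h : LinearMap.ker f = LinearMap.ker g) :
    Module.length R (LinearMap.range f) = Module.length R (LinearMap.range g) :=
  (f.quotKerEquivRange.symm ≪≫ₗ Submodule.quotEquivOfEq _ _ h ≪≫ₗ g.quotKerEquivRange).length_eq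

/-- The kernel and the cokernel of multiplication by `x`, as a map from `F` to `M / G`, have the
expected lengths. -/
theorem Submodule.length_quotient_add_length_quotient (x : R) (F G : Submodule R M) :
    Module.length R (M ⧸ G) + Module.length R (M ⧸ F) =
      Module.length R (M ⧸ (F.map (LinearMap.lsmul R M x) ⊔ G)) +
        Module.length R (M ⧸ (F ⊓ G.comap (LinearMap.lsmul R M x))) := by
  set K := F ⊓ G.comap (LinearMap.lsmul R M x) with hK
  set H := F.map (LinearMap.lsmul R M x) ⊔ G with hH
  -- Both sides are the image of `F` under multiplication by `x` into `M / G`.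
  have h : Module.length R (H.map G.mkQ) = Module.length R (F.map K.mkQ) := by
    have e1 : H.map G.mkQ =
        LinearMap.range ((G.mkQ ∘ₗ LinearMap.lsmul R M x) ∘ₗ F.subtype) := by
      rw [LinearMap.range_comp, Submodule.range_subtype, Submodule.map_comp, hH,
        Submodule.map_sup, Submodule.mkQ_map_self, sup_bot_eq]
    have e2 : F.map K.mkQ = LinearMap.range (K.mkQ ∘ₗ F.subtype) := by
      rw [LinearMap.range_comp, Submodule.range_subtype]
    rw [e1, e2]
    refine LinearMap.length_range_eq_of_ker_eq _ _ ?_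
    ext y
    simp [hK, ← Submodule.Quotient.mk_smul]
  rw [Submodule.length_quotient_eq_add_length_map (le_sup_right : G ≤ H),
    Submodule.length_quotient_eq_add_length_map (inf_le_left : K ≤ F), h]
  ring

end Length

/-! ### The Hilbert–Serre theorem for filtrations. -/

section HilbertSerre

variable {R M : Type*} [CommRing R] [AddCommGroup M] [Module R M] {Q : Ideal R}

/-- The shift of a filtration. -/
def Ideal.Filtration.shift (F : Q.Filtration M) : Q.Filtration M where
  N n := F.N (n + 1)
  mono n := F.mono (n + 1)
  smul_le n := F.smul_le (n + 1)

theorem Ideal.Filtration.Stable.shift {F : Q.Filtration M} (h : F.Stable) : F.shift.Stable := by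
  obtain ⟨n₀, hn₀⟩ := h
  exact ⟨n₀, fun n hn ↦ hn₀ (n + 1) (by omega)⟩

/-- The kernel of multiplication by `x` from `F n` to `M / G (n + 1)`. -/
def Ideal.Filtration.kerSMul (F G : Q.Filtration M) (x : R) : Q.Filtration M where
  N n := F.N n ⊓ (G.N (n + 1)).comap (LinearMap.lsmul R M x)
  mono n := inf_le_inf (F.mono n) (Submodule.comap_mono (G.mono (n + 1)))
  smul_le n := by
    refine le_inf ((smul_mono_right _ inf_le_left).trans (F.smul_le n)) ?_
    rw [← Submodule.map_le_iff_le_comap, Submodule.map_smul'']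
    refine (smul_mono_right _ ?_).trans (G.smul_le (n + 1))
    rw [Submodule.map_le_iff_le_comap]
    exact inf_le_right

/-- The filtration `n ↦ x F n + G (n + 1)`. -/
def Ideal.Filtration.imageSMul (F G : Q.Filtration M) (x : R) : Q.Filtration M where
  N n := (F.N n).map (LinearMap.lsmul R M x) ⊔ G.N (n + 1)
  mono n := sup_le_sup (Submodule.map_mono (F.mono n)) (G.mono (n + 1))
  smul_le n := by
    rw [Submodule.smul_sup, ← Submodule.map_smul'']
    exact sup_le_sup (Submodule.map_mono (F.smul_le n)) (G.smul_le (n + 1))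

/-- The **Hilbert–Serre theorem** for a pair `G ≤ F` of filtrations: the length of `F n / G n` is
eventually a polynomial of degree smaller than the number of generators of the filtering ideal that
do not send `F n` into `G (n + 1)`. -/
theorem Ideal.Filtration.isEventuallyBinomial_sub [IsNoetherianRing R] [Module.Finite R M]
    (s : Finset R) (hs : ∀ x ∈ s, x ∈ Q) (J : Ideal R) (hQ : Q ≤ Ideal.span s ⊔ J)
    (F G : Q.Filtration M) (hF : F.Stable) (hGF : G ≤ F)
    (hJ : ∀ n, J • F.N n ≤ G.N (n + 1)) (hfin : ∀ n, Module.length R (M ⧸ G.N n) ≠ ⊤) :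
    IsEventuallyBinomial s.card (fun n ↦ ((Module.length R (M ⧸ G.N n)).toNat : ℤ) -
      (Module.length R (M ⧸ F.N n)).toNat) := by
  classical
  -- `J` collects the generators already used. Multiplication by `x` from `F n / G n` to `F (n + 1)
  -- / G (n + 1)` has kernel and cokernel killed by `x`; both come from pairs of filtrations needing
  -- one generator fewer, and their lengths give the first difference. When no generator is left, `F
  -- (n + 1) = Q F n ⊆ J F n ⊆ G (n + 1)` by stability.
  induction s using Finset.induction_on generalizing J F G with
  | empty =>
    obtain ⟨n₀, hn₀⟩ := hF
    refine .of_eventually_eq_zero (Filter.eventually_atTop.mpr ⟨n₀ + 1, fun n hn ↦ ?_⟩)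
    obtain ⟨n, rfl⟩ : ∃ m, n = m + 1 := ⟨n - 1, by omega⟩
    have : G.N (n + 1) = F.N (n + 1) := by
      refine le_antisymm (hGF (n + 1)) ?_
      rw [← hn₀ n (by omega)]
      refine (Submodule.smul_mono_left ?_).trans (hJ n)
      simpa using hQ
    rw [this, sub_self]
  | insert x s hx ih =>
    have hFfin (n : ℕ) : Module.length R (M ⧸ F.N n) ≠ ⊤ :=
      ((Submodule.length_quotient_anti (hGF n)).trans_lt (hfin n).lt_top).ne
    have hxQ : x ∈ Q := hs x (Finset.mem_insert_self x s)
    have hs' : ∀ y ∈ s, y ∈ Q := fun y hy ↦ hs y (Finset.mem_insert_of_mem hy)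
    have hQ' : Q ≤ Ideal.span s ⊔ (Ideal.span {x} ⊔ J) := by
      rwa [Finset.coe_insert, Ideal.span_insert, sup_comm (Ideal.span {x}), sup_assoc] at hQ
    have hKF : F.kerSMul G x ≤ F := fun n ↦ inf_le_left
    have hGK : G ≤ F.kerSMul G x := fun n ↦ by
      refine le_inf (hGF n) fun y hy ↦ ?_
      exact G.smul_le n (Submodule.smul_mem_smul hxQ hy)
    have hspan (N : Submodule R M) :
        Ideal.span {x} • N = N.map (LinearMap.lsmul R M x) := by
      rw [Submodule.ideal_span_singleton_smul]
      rfl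
    -- The kernel filtration is stable because it lies below a stable one over a Noetherian ring, as
    -- in Artin–Rees.
    have hK := ih hs' (Ideal.span {x} ⊔ J) hQ' (F.kerSMul G x) G (hF.of_le hKF) hGK
      (fun n ↦ by
        rw [Submodule.sup_smul, hspan]
        refine sup_le ?_ ((smul_mono_right _ inf_le_left).trans (hJ n))
        rw [Submodule.map_le_iff_le_comap]
        exact inf_le_right) hfin
    have hH := ih hs' (Ideal.span {x} ⊔ J) hQ' F.shift (F.imageSMul G x) hF.shift
      (fun n ↦ by
        refine sup_le ?_ (hGF (n + 1))
        rw [← hspan]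
        refine (Submodule.smul_mono_left ?_).trans (F.smul_le n)
        simpa [Ideal.span_le] using hxQ)
      (fun n ↦ by
        rw [Submodule.sup_smul, hspan]
        exact sup_le_sup le_rfl (hJ (n + 1)))
      (fun n ↦ ((Submodule.length_quotient_anti le_sup_right).trans_lt (hfin (n + 1)).lt_top).ne)
    rw [Finset.card_insert_of_notMem hx]
    refine .of_difference ?_
    convert hH.sub hK using 2 with n
    have key : Module.length R (M ⧸ G.N (n + 1)) + Module.length R (M ⧸ F.N n) =
        Module.length R (M ⧸ (F.imageSMul G x).N n) +
          Module.length R (M ⧸ (F.kerSMul G x).N n) :=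
      Submodule.length_quotient_add_length_quotient x (F.N n) (G.N (n + 1))
    have h1 := hfin (n + 1)
    have h2 := hFfin n
    have h3 : Module.length R (M ⧸ (F.imageSMul G x).N n) ≠ ⊤ :=
      ((Submodule.length_quotient_anti le_sup_right).trans_lt (hfin (n + 1)).lt_top).ne
    have h4 : Module.length R (M ⧸ (F.kerSMul G x).N n) ≠ ⊤ :=
      ((Submodule.length_quotient_anti (hGK n)).trans_lt (hfin n).lt_top).ne
    have key' := congrArg ENat.toNat key
    rw [ENat.toNat_add h1 h2, ENat.toNat_add h3 h4] at key'
    have h5 : (Module.length R (M ⧸ F.shift.N n)).toNat =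
      (Module.length R (M ⧸ F.N (n + 1))).toNat := rfl
    rw [h5]
    omega

/-- The **Hilbert–Samuel function** of a stable filtration of finite colength is eventually a
polynomial, of degree at most the number of generators of the filtering ideal. -/
theorem Ideal.Filtration.Stable.isEventuallyBinomial [IsNoetherianRing R] [Module.Finite R M]
    (s : Finset R) (hQ : Q = Ideal.span s) {F : Q.Filtration M} (hF : F.Stable)
    (hfin : ∀ n, Module.length R (M ⧸ F.N n) ≠ ⊤) :
    IsEventuallyBinomial (s.card + 1) (fun n ↦ ((Module.length R (M ⧸ F.N n)).toNat : ℤ)) :=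
  .of_difference <| Ideal.Filtration.isEventuallyBinomial_sub s
    (fun x hx ↦ hQ ▸ Ideal.subset_span hx) ⊥ (by simp [hQ]) F F.shift hF (fun n ↦ F.mono n)
    (fun n ↦ by simp) (fun n ↦ hfin (n + 1))

end HilbertSerre

/-! ### Powers of ideals generated by regular sequences. -/

section RegularSequence

open RingTheory.Sequence
open scoped Pointwise

variable {R : Type*} [CommRing R]

/-- A product of `n + 1` factors from `I + J` either uses a factor from `I` or lies in `J ^ (n +
1)`. -/
theorem Ideal.sup_pow_succ_le (I J : Ideal R) (n : ℕ) :
    (I ⊔ J) ^ (n + 1) ≤ I * (I ⊔ J) ^ n ⊔ J ^ (n + 1) := by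
  induction n with
  | zero => simp
  | succ n ih =>
    rw [pow_succ' (I ⊔ J) (n + 1), Ideal.sup_mul]
    refine sup_le le_sup_left ((Ideal.mul_mono_right ih).trans ?_)
    rw [Ideal.mul_sup, ← pow_succ']
    refine sup_le_sup ?_ le_rfl
    rw [mul_left_comm, pow_succ' (I ⊔ J) n]
    exact Ideal.mul_mono_right (Ideal.mul_mono_left le_sup_right)

variable {M : Type*} [AddCommGroup M] [Module R M]

/-- If `y` is regular modulo all powers of `J`, then it is superficial for `(y) + J`. -/
theorem mem_pow_smul_top_of_smul_mem {y : R} {J : Ideal R} {n : ℕ}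
    (hy : ∀ m : M, y • m ∈ J ^ (n + 1) • (⊤ : Submodule R M) →
      m ∈ J ^ (n + 1) • (⊤ : Submodule R M)) {m : M}
    (hm : y • m ∈ (Ideal.span {y} ⊔ J) ^ (n + 1) • (⊤ : Submodule R M)) :
    m ∈ (Ideal.span {y} ⊔ J) ^ n • (⊤ : Submodule R M) := by
  have h := Submodule.smul_mono_left (Ideal.sup_pow_succ_le (Ideal.span {y}) J n) hm
  rw [Submodule.sup_smul, Submodule.mul_smul, Submodule.ideal_span_singleton_smul,
    Submodule.mem_sup] at h
  obtain ⟨u, hu, v, hv, huv⟩ := h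
  obtain ⟨w, hw, rfl⟩ := (Submodule.mem_smul_pointwise_iff_exists _ _ _).mp hu
  have h1 : y • (m - w) ∈ J ^ (n + 1) • (⊤ : Submodule R M) := by
    rw [smul_sub, ← huv, add_sub_cancel_left]
    exact hv
  have h2 : m - w ∈ (Ideal.span {y} ⊔ J) ^ n • (⊤ : Submodule R M) :=
    Submodule.smul_mono_left ((Ideal.pow_le_pow_right n.le_succ).trans
      (Ideal.pow_right_mono le_sup_right n)) (hy _ h1)
  simpa using Submodule.add_mem _ h2 hw

theorem map_mkQ_sup_pow_smul_top (y : R) (J : Ideal R) (n : ℕ) :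
    ((Ideal.span {y} ⊔ J) ^ (n + 1) • (⊤ : Submodule R M)).map
      (y • (⊤ : Submodule R M)).mkQ = J ^ (n + 1) • (⊤ : Submodule R (QuotSMulTop y M)) := by
  rw [Submodule.map_smul'', Submodule.map_top, Submodule.range_mkQ]
  refine le_antisymm ?_ (Submodule.smul_mono_left (Ideal.pow_right_mono le_sup_right _))
  refine (Submodule.smul_mono_left (Ideal.sup_pow_succ_le (Ideal.span {y}) J n)).trans ?_
  rw [Submodule.sup_smul, mul_comm, Submodule.mul_smul]
  refine sup_le ?_ le_rfl
  have : Ideal.span {y} • (⊤ : Submodule R (QuotSMulTop y M)) = ⊥ := by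
    rw [Submodule.ideal_span_singleton_smul, eq_bot_iff]
    rintro _ ⟨x, -, rfl⟩
    obtain ⟨x, rfl⟩ := Submodule.mkQ_surjective _ x
    change y • (y • (⊤ : Submodule R M)).mkQ x = 0
    rw [← map_smul, Submodule.mkQ_apply, Submodule.Quotient.mk_eq_zero]
    exact Submodule.smul_mem_pointwise_smul x y ⊤ trivial
  rw [this, Submodule.smul_bot]
  exact bot_le

variable [IsLocalRing R] [IsNoetherianRing R]

/-- If `z, y₁, …, yᵣ` is a regular sequence, then `z` is regular modulo all powers of
`(y₁, …, yᵣ)`. -/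
theorem RingTheory.Sequence.IsWeaklyRegular.mem_pow_smul_top [Module.Finite R M] {z : R}
    {rs : List R} (h : IsWeaklyRegular M (z :: rs)) (hmem : ∀ r ∈ z :: rs, r ∈ maximalIdeal R)
    (k : ℕ) (m : M) (hm : z • m ∈ Ideal.ofList rs ^ k • (⊤ : Submodule R M)) :
    m ∈ Ideal.ofList rs ^ k • (⊤ : Submodule R M) := by
  induction rs generalizing M z k with
  | nil =>
    cases k with
    | zero => simp
    | succ k =>
      have hz := ((isWeaklyRegular_cons_iff M z []).mp h).1
      simp only [Ideal.ofList_nil, Ideal.bot_pow (Nat.succ_ne_zero k), Submodule.bot_smul,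
        Submodule.mem_bot] at hm ⊢
      exact hz (by simpa using hm)
  | cons y rs ih =>
    -- Regular sequences in the maximal ideal may be permuted. The induction thus applies to `z`
    -- over `M / yM`, and to `y` over `M`, where it makes `y` superficial.
    have hbar : IsWeaklyRegular (QuotSMulTop y M) (z :: rs) :=
      ((isWeaklyRegular_cons_iff M y (z :: rs)).mp
        (isWeaklyRegular_of_perm_of_subset_maximalIdeal h (List.Perm.swap y z rs) hmem)).2
    have hy : IsWeaklyRegular M (y :: rs) :=
      ((isWeaklyRegular_append_iff M (y :: rs) [z]).mp
        (isWeaklyRegular_of_perm_of_subset_maximalIdeal h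
          (List.perm_append_singleton z (y :: rs)).symm hmem)).1
    have hyr : ∀ r ∈ y :: rs, r ∈ maximalIdeal R := fun r hr ↦ hmem r (List.mem_cons_of_mem z hr)
    have hzr : ∀ r ∈ z :: rs, r ∈ maximalIdeal R := fun r hr ↦ hmem r <| by
      rcases List.mem_cons.mp hr with rfl | hr
      · exact List.mem_cons_self
      · exact List.mem_cons_of_mem _ (List.mem_cons_of_mem _ hr)
    rw [Ideal.ofList_cons] at hm ⊢
    induction k generalizing m with
    | zero => simp
    | succ k ihk =>
      -- Modulo `y` the claim is known, so `m = w - y v` with `w` in the power. Then `y z v` is in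
      -- the power too; superficiality of `y` puts `z v` in the `k`-th power, and the inner
      -- induction does the same for `v`.
      have h1 := Submodule.mem_map_of_mem (f := (y • (⊤ : Submodule R M)).mkQ) hm
      rw [map_mkQ_sup_pow_smul_top, map_smul] at h1
      have h2 := ih hbar hzr (k + 1) _ h1
      rw [← map_mkQ_sup_pow_smul_top] at h2
      obtain ⟨w, hw, hwm⟩ := h2
      rw [Submodule.mkQ_apply, Submodule.mkQ_apply, Submodule.Quotient.eq] at hwm
      obtain ⟨v, -, hv⟩ := (Submodule.mem_smul_pointwise_iff_exists _ _ _).mp hwm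
      have hm' : m = w - y • v := by rw [hv]; abel
      have h3 : y • z • v ∈ (Ideal.span {y} ⊔ Ideal.ofList rs) ^ (k + 1) •
          (⊤ : Submodule R M) := by
        have : y • z • v = z • w - z • m := by rw [hm', smul_sub, smul_comm y z]; abel
        rw [this]
        exact Submodule.sub_mem _ (Submodule.smul_mem _ _ hw) hm
      have h4 := ihk v (mem_pow_smul_top_of_smul_mem (fun m ↦ ih hy hyr (k + 1) m) h3)
      rw [hm']
      refine Submodule.sub_mem _ hw ?_
      rw [pow_succ', Submodule.mul_smul]
      exact Submodule.smul_mem_smul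
        (Ideal.mem_sup_left (Ideal.mem_span_singleton_self y)) h4

/-- The Hilbert–Samuel function of an ideal generated by a regular sequence. -/
theorem RingTheory.Sequence.IsWeaklyRegular.length_quotient_pow_smul_top [Module.Finite R M]
    {rs : List R} (h : IsWeaklyRegular M rs) (hmem : ∀ r ∈ rs, r ∈ maximalIdeal R) (n : ℕ) :
    Module.length R (M ⧸ Ideal.ofList rs ^ (n + 1) • (⊤ : Submodule R M)) =
      ((n + rs.length).choose rs.length : ℕ) *
        Module.length R (M ⧸ Ideal.ofList rs • (⊤ : Submodule R M)) := by
  induction rs generalizing M n with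
  | nil =>
    rw [Ideal.ofList_nil, Ideal.bot_pow (Nat.succ_ne_zero n)]
    simp
  | cons y rs ih =>
    have hbar := ((isWeaklyRegular_cons_iff M y rs).mp h).2
    have hrs : ∀ r ∈ rs, r ∈ maximalIdeal R := fun r hr ↦ hmem r (List.mem_cons_of_mem y hr)
    have e1 := (Submodule.quotOfListConsSMulTopEquivQuotSMulTopInner M y rs).length_eq
    induction n with
    | zero =>
      rw [zero_add, pow_one]
      simp
    | succ n ihn =>
      set Q := Ideal.ofList (y :: rs) with hQ
      have hQ' : Q = Ideal.span {y} ⊔ Ideal.ofList rs := Ideal.ofList_cons y rs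
      -- On `M / Q ^ (n + 2) M`, multiplication by `y` has its cokernel computed over `M / yM`, and
      -- the colon is `Q ^ (n + 1) M`. The recursion is Pascal's rule.
      have key := Submodule.length_quotient_add_length_quotient y ⊤
        (Q ^ (n + 1 + 1) • (⊤ : Submodule R M))
      have hcolon : ⊤ ⊓ (Q ^ (n + 1 + 1) • (⊤ : Submodule R M)).comap (LinearMap.lsmul R M y) =
          Q ^ (n + 1) • (⊤ : Submodule R M) := by
        rw [top_inf_eq]
        refine le_antisymm (fun m hm ↦ ?_) ?_
        · rw [hQ'] at hm ⊢
          exact mem_pow_smul_top_of_smul_mem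
            (fun m hm ↦ h.mem_pow_smul_top hmem (n + 1 + 1) m hm) hm
        · intro m hm
          rw [pow_succ', Submodule.mul_smul]
          refine Submodule.smul_mem_smul (?_ : y ∈ Q) hm
          rw [hQ']
          exact Ideal.mem_sup_left (Ideal.mem_span_singleton_self y)
      have e2 : Module.length R
          (M ⧸ ((⊤ : Submodule R M).map (LinearMap.lsmul R M y) ⊔ Q ^ (n + 1 + 1) • ⊤)) =
          Module.length R (QuotSMulTop y M ⧸
            Ideal.ofList rs ^ (n + 1 + 1) • (⊤ : Submodule R (QuotSMulTop y M))) := by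
        have h1 : (⊤ : Submodule R M).map (LinearMap.lsmul R M y) = y • ⊤ := rfl
        have h2 := map_mkQ_sup_pow_smul_top (M := M) y (Ideal.ofList rs) (n + 1)
        rw [← hQ'] at h2
        exact (Submodule.quotEquivOfEq _ _ (congrArg (· ⊔ Q ^ (n + 1 + 1) • ⊤) h1) ≪≫ₗ
          (Submodule.quotientQuotientEquivQuotientSup (y • ⊤) (Q ^ (n + 1 + 1) • ⊤)).symm ≪≫ₗ
          Submodule.quotEquivOfEq _ _ h2).length_eq
      have e3 : Module.length R (M ⧸ (⊤ : Submodule R M)) = 0 := Module.length_eq_zero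
      rw [hcolon, e2, e3, add_zero, ih hbar hrs, ← e1, ihn, ← add_mul] at key
      rw [key]
      congr 1
      rw [List.length_cons, show n + 1 + (rs.length + 1) = (n + 1 + rs.length) + 1 by ring,
        Nat.choose_succ_succ, show n + (rs.length + 1) = n + 1 + rs.length by ring]
      push_cast
      rfl

end RegularSequence

/-! ### Prime avoidance, parameters and finite length. -/

section Dimension

variable {R : Type*} [CommRing R]

/-- Prime avoidance for a coset of an ideal. -/
theorem Ideal.exists_add_notMem_of_finite (I : Ideal R) (y : R) {S : Set (Ideal R)}
    (hfin : S.Finite) (hprime : ∀ p ∈ S, p.IsPrime) (hanti : ∀ p ∈ S, ∀ q ∈ S, p ≤ q → p = q)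
    (h : ∀ p ∈ S, I ≤ p → y ∉ p) : ∃ z ∈ I, ∀ p ∈ S, y + z ∉ p := by
  classical
  obtain ⟨T, rfl⟩ := hfin.exists_finset_coe
  simp only [Finset.mem_coe] at *
  -- The element `z` is to lie in `I` and in every `p` not containing `y`, yet outside every `p`
  -- containing `y`; then `y + z` is outside all of them.
  let J : Ideal R := I ⊓ (T.filter (y ∉ ·)).inf id
  have hJ : ¬ ((J : Set R) ⊆ ⋃ p ∈ ((T.filter (y ∈ ·) : Finset (Ideal R)) : Set (Ideal R)),
      (id p : Ideal R)) := by
    rw [Ideal.subset_union_prime (f := id) ⊤ ⊤ (fun p hp _ _ ↦ hprime p (Finset.mem_filter.mp hp).1)]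
    rintro ⟨p, hp, hJp⟩
    obtain ⟨hpT, hyp⟩ := Finset.mem_filter.mp hp
    have := hprime p hpT
    rcases this.inf_le.mp hJp with hI | hinf
    · exact h p hpT hI hyp
    · obtain ⟨q, hq, hqp⟩ := (Ideal.IsPrime.inf_le' this).mp hinf
      obtain ⟨hqT, hyq⟩ := Finset.mem_filter.mp hq
      exact hyq (hanti q hqT p hpT hqp ▸ hyp)
  obtain ⟨z, hzJ, hz⟩ := Set.not_subset.mp hJ
  refine ⟨z, hzJ.1, fun p hp hmem ↦ ?_⟩
  by_cases hyp : y ∈ p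
  · exact hz (Set.mem_biUnion (Finset.mem_coe.mpr (Finset.mem_filter.mpr ⟨hp, hyp⟩))
      ((Submodule.add_mem_iff_right p hyp).mp hmem))
  · have hzp : z ∈ p := Finset.inf_le (f := id) (Finset.mem_filter.mpr ⟨hp, hyp⟩) hzJ.2
    exact hyp ((Submodule.add_mem_iff_left p hzp).mp hmem)

theorem ringKrullDim_quotient_anti {I J : Ideal R} (h : I ≤ J) :
    ringKrullDim (R ⧸ J) ≤ ringKrullDim (R ⧸ I) :=
  ringKrullDim_le_of_surjective (Ideal.Quotient.factor h) (Ideal.Quotient.factor_surjective h)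

/-- A chain of primes all containing `I` bounds the dimension of `R / I` from below. -/
theorem LTSeries.length_le_ringKrullDim_quotient (p : LTSeries (PrimeSpectrum R)) {I : Ideal R}
    (h : I ≤ p.head.asIdeal) : (p.length : WithBot ℕ∞) ≤ ringKrullDim (R ⧸ I) := by
  rw [ringKrullDim_quotient]
  let q : LTSeries (PrimeSpectrum.zeroLocus (I : Set R)) :=
    { length := p.length
      toFun := fun i ↦ ⟨p i, h.trans (p.head_le i)⟩
      step := fun i ↦ p.step i }
  exact Order.LTSeries.length_le_krullDim q

/-- Only minimal primes `p` of `J` with `dim R / p > m` must be avoided. None contains both `I` and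
`y`, since `dim R / (I + J + (y)) ≤ m`, so some member of the coset `y + I` avoids them all. -/
theorem exists_ringKrullDim_quotient_sup_span_singleton_le [IsNoetherianRing R]
    (I J : Ideal R) (y : R) (m : ℕ)
    (hJ : ringKrullDim (R ⧸ J) ≤ ((m + 1 : ℕ) : WithBot ℕ∞))
    (hy : ringKrullDim (R ⧸ (I ⊔ J ⊔ Ideal.span {y})) ≤ (m : WithBot ℕ∞)) :
    ∃ z ∈ I, ringKrullDim (R ⧸ (J ⊔ Ideal.span {y + z})) ≤ (m : WithBot ℕ∞) := by
  let S : Set (Ideal R) :=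
    {p | p ∈ J.minimalPrimes ∧ ¬ ringKrullDim (R ⧸ p) ≤ (m : WithBot ℕ∞)}
  have hS : S ⊆ J.minimalPrimes := fun p hp ↦ hp.1
  obtain ⟨z, hzI, hz⟩ := I.exists_add_notMem_of_finite y
    ((J.finite_minimalPrimes_of_isNoetherianRing R).subset hS) (fun p hp ↦ hp.1.1.1)
    (fun p hp q hq hpq ↦ le_antisymm hpq (hq.1.2 hp.1.1 hpq))
    (fun p hp hIp hyp ↦ hp.2 <| (ringKrullDim_quotient_anti (sup_le (sup_le hIp hp.1.1.2)
      ((Ideal.span_singleton_le_iff_mem p).mpr hyp))).trans hy)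
  refine ⟨z, hzI, ?_⟩
  rw [ringKrullDim_quotient]
  refine iSup_le fun p ↦ ?_
  let p' : LTSeries (PrimeSpectrum R) := p.map Subtype.val fun _ _ h ↦ h
  have hp' : J ⊔ Ideal.span {y + z} ≤ p'.head.asIdeal := p.head.2
  obtain ⟨q, hq, hqp⟩ := Ideal.exists_minimalPrimes_le (le_sup_left.trans hp')
  by_cases hqS : ringKrullDim (R ⧸ q) ≤ (m : WithBot ℕ∞)
  · exact (p'.length_le_ringKrullDim_quotient hqp).trans hqS
  -- Here `q` lies strictly below the chain and prolongs it by one, so `dim R / J ≤ m + 1` bounds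
  -- the chain by `m`.
  · have hyz : y + z ∉ q := hz q ⟨hq, hqS⟩
    have hlt : (⟨q, hq.1.1⟩ : PrimeSpectrum R) < p'.head := by
      refine lt_of_le_of_ne hqp fun heq ↦ hyz ?_
      have : q = p'.head.asIdeal := congrArg PrimeSpectrum.asIdeal heq
      rw [this]
      exact hp' (Ideal.mem_sup_right (Ideal.mem_span_singleton_self _))
    have h1 := (LTSeries.length_le_ringKrullDim_quotient (p'.cons _ hlt) (I := J)
      (by simpa using hq.1.2)).trans hJ
    have h2 : p.length + 1 ≤ m + 1 := by
      have : (p'.cons _ hlt).length = p.length + 1 := RelSeries.cons_length _ _ _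
      rw [this] at h1
      exact_mod_cast h1
    exact_mod_cast Nat.le_of_succ_le_succ h2

/-- If `rs` cuts down the dimension of `R / (I + J)` as much as possible, then its members can be
changed modulo `I` so that it cuts down the dimension of `R / J` as much as possible. -/
theorem exists_list_ringKrullDim_quotient_le_zero [IsNoetherianRing R] (I J : Ideal R)
    (rs : List R) (hJ : ringKrullDim (R ⧸ J) ≤ (rs.length : WithBot ℕ∞))
    (hrs : ∀ l₁ l₂, rs = l₁ ++ l₂ →
      ringKrullDim (R ⧸ (I ⊔ J ⊔ Ideal.ofList l₁)) ≤ (l₂.length : WithBot ℕ∞)) :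
    ∃ ys : List R, ys.length = rs.length ∧ I ⊔ Ideal.ofList ys = I ⊔ Ideal.ofList rs ∧
      ringKrullDim (R ⧸ (J ⊔ Ideal.ofList ys)) ≤ 0 := by
  induction rs generalizing J with
  | nil => exact ⟨[], rfl, rfl, by rw [Ideal.ofList_nil, sup_bot_eq]; simpa using hJ⟩
  | cons y rs ih =>
    obtain ⟨z, hz, hdim⟩ := exists_ringKrullDim_quotient_sup_span_singleton_le I J y rs.length
      (by simpa using hJ) (by rw [← Ideal.ofList_singleton]; exact hrs [y] rs rfl)
    have hspan : I ⊔ Ideal.span {y + z} = I ⊔ Ideal.span {y} := by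
      refine le_antisymm (sup_le le_sup_left ?_) (sup_le le_sup_left ?_) <;>
        rw [Ideal.span_singleton_le_iff_mem]
      · exact add_mem (Ideal.mem_sup_right (Ideal.mem_span_singleton_self y))
          (Ideal.mem_sup_left hz)
      · simpa using sub_mem (Ideal.mem_sup_right (S := I)
          (Ideal.mem_span_singleton_self (y + z))) (Ideal.mem_sup_left hz)
    obtain ⟨ys, hlen, hys, hysdim⟩ := ih (J ⊔ Ideal.span {y + z}) hdim fun l₁ l₂ h ↦ by
      have h1 := hrs (y :: l₁) l₂ (by rw [h]; rfl)
      have h2 : I ⊔ (J ⊔ Ideal.span {y + z}) ⊔ Ideal.ofList l₁ =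
          I ⊔ J ⊔ Ideal.ofList (y :: l₁) := by
        rw [Ideal.ofList_cons, sup_left_comm, hspan]
        ac_rfl
      rwa [h2]
    refine ⟨(y + z) :: ys, by simp [hlen], ?_, ?_⟩
    · rw [Ideal.ofList_cons, Ideal.ofList_cons, ← sup_assoc, hspan, sup_right_comm, hys]
      ac_rfl
    · rwa [Ideal.ofList_cons, ← sup_assoc]

variable [IsLocalRing R]

theorem IsLocalRing.maximalIdeal_le_radical_of_ringKrullDim_quotient_le_zero {Q : Ideal R}
    (h : ringKrullDim (R ⧸ Q) ≤ 0) : maximalIdeal R ≤ Q.radical := by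
  have : Ring.KrullDimLE 0 (R ⧸ Q) := Ring.krullDimLE_iff.mpr (by simpa using h)
  rw [Ideal.radical_eq_sInf]
  refine le_sInf fun p hp ↦ ?_
  have hpQ : Q ≤ p := hp.1
  have := hp.2
  have hprime : (p.map (Ideal.Quotient.mk Q)).IsPrime := Ideal.isPrime_map_quotientMk_of_isPrime hpQ
  have hmax := Ring.krullDimLE_zero_iff.mp ‹_› _ hprime
  have h1 := Ideal.comap_isMaximal_of_surjective (Ideal.Quotient.mk Q)
    Ideal.Quotient.mk_surjective (K := p.map (Ideal.Quotient.mk Q))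
  rw [Ideal.comap_map_of_surjective _ Ideal.Quotient.mk_surjective, ← RingHom.ker_eq_comap_bot,
    Ideal.mk_ker, sup_eq_left.mpr hpQ] at h1
  rw [eq_maximalIdeal h1]

variable [IsNoetherianRing R]

theorem IsLocalRing.exists_maximalIdeal_pow_le {Q : Ideal R}
    (h : ringKrullDim (R ⧸ Q) ≤ 0) : ∃ k, maximalIdeal R ^ k ≤ Q := by
  obtain ⟨k, hk⟩ := Q.exists_radical_pow_le_of_fg (IsNoetherian.noetherian _)
  exact ⟨k, (Ideal.pow_right_mono
    (maximalIdeal_le_radical_of_ringKrullDim_quotient_le_zero h) k).trans hk⟩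

theorem IsLocalRing.length_quotient_ne_top {M : Type*} [AddCommGroup M] [Module R M]
    [Module.Finite R M] {N : Submodule R M} {k : ℕ}
    (h : maximalIdeal R ^ k • (⊤ : Submodule R M) ≤ N) : Module.length R (M ⧸ N) ≠ ⊤ := by
  -- The nonzero exponent keeps the power inside the maximal ideal even for `k = 0`.
  set I := maximalIdeal R ^ (k + 1) with hI
  have h' : I • (⊤ : Submodule R M) ≤ N :=
    (Submodule.smul_mono_left (Ideal.pow_le_pow_right k.le_succ)).trans h
  refine ((Submodule.length_quotient_anti h').trans_lt (lt_top_iff_ne_top.mpr ?_)).ne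
  have hmin : maximalIdeal R ∈ I.minimalPrimes :=
    ⟨⟨inferInstance, Ideal.pow_le_self k.succ_ne_zero⟩,
      fun q hq _ ↦ hq.1.le_of_pow_le hq.2⟩
  have := quotient_artinian_of_mem_minimalPrimes_of_isLocalRing I hmin
  have hsurj : Function.Surjective (algebraMap R (R ⧸ I)) := Ideal.Quotient.mk_surjective
  have : Module.Finite (R ⧸ I) (M ⧸ I • (⊤ : Submodule R M)) :=
    Module.Finite.of_restrictScalars_finite R _ _
  rw [Module.length_eq_of_surjective (R := R ⧸ I) hsurj]
  exact Module.length_ne_top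

/-- The Hilbert–Samuel function of `M` has degree at most `dim M`. -/
theorem IsLocalRing.exists_isEventuallyBinomial_of_supportDim_le {M : Type*} [AddCommGroup M]
    [Module R M] [Module.Finite R M] {r : ℕ} (h : Module.supportDim R M ≤ (r : WithBot ℕ∞)) :
    ∃ q : Ideal R, q ≤ maximalIdeal R ∧
      (∀ n, Module.length R (M ⧸ q ^ n • (⊤ : Submodule R M)) ≠ ⊤) ∧
      IsEventuallyBinomial (r + 1)
        (fun n ↦ ((Module.length R (M ⧸ q ^ n • (⊤ : Submodule R M))).toNat : ℤ)) := by
  classical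
  rw [Module.supportDim_eq_ringKrullDim_quotient_annihilator] at h
  -- Changing `r` zeros modulo the maximal ideal yields `r` parameters modulo the annihilator of
  -- `M`.
  obtain ⟨zs, hlen, hmax, hdim⟩ := exists_list_ringKrullDim_quotient_le_zero (maximalIdeal R)
    (Module.annihilator R M) (List.replicate r 0) (by simpa using h) fun l₁ l₂ _ ↦ by
      refine (ringKrullDim_quotient_anti (le_sup_left.trans le_sup_left)).trans ?_
      have : ringKrullDim (R ⧸ maximalIdeal R) = 0 :=
        ringKrullDim_eq_zero_of_field (ResidueField R)
      rw [this]
      exact_mod_cast Nat.zero_le _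
  have hle : Ideal.ofList zs ≤ maximalIdeal R := by
    have h0 : Ideal.ofList (List.replicate r (0 : R)) ≤ maximalIdeal R := by
      refine Ideal.span_le.mpr fun x hx ↦ ?_
      rw [List.eq_of_mem_replicate hx]
      exact zero_mem _
    rw [sup_eq_left.mpr h0] at hmax
    exact sup_eq_left.mp hmax
  have hsmul (N : Submodule R M) :
      (Module.annihilator R M ⊔ Ideal.ofList zs) • N = Ideal.ofList zs • N := by
    have : Module.annihilator R M • N = ⊥ := by
      rw [eq_bot_iff, Submodule.smul_le]
      intro a ha n _
      exact (Submodule.mem_bot R).mpr (Module.mem_annihilator.mp ha n)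
    rw [Submodule.sup_smul, this, bot_sup_eq]
  have hpow (n : ℕ) : (Module.annihilator R M ⊔ Ideal.ofList zs) ^ n • (⊤ : Submodule R M) =
      Ideal.ofList zs ^ n • ⊤ := by
    induction n with
    | zero => simp
    | succ n ih => rw [pow_succ', pow_succ', Submodule.mul_smul, Submodule.mul_smul, ih, hsmul]
  obtain ⟨k, hk⟩ := exists_maximalIdeal_pow_le hdim
  have hfin (n : ℕ) : Module.length R (M ⧸ Ideal.ofList zs ^ n • (⊤ : Submodule R M)) ≠ ⊤ := by
    refine length_quotient_ne_top (k := k * n) ?_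
    rw [← hpow, pow_mul]
    exact Submodule.smul_mono_left (Ideal.pow_right_mono hk n)
  refine ⟨Ideal.ofList zs, hle, hfin, ?_⟩
  have hspan : Ideal.ofList zs = Ideal.span (zs.toFinset : Set R) := by
    simp [Ideal.ofList, List.coe_toFinset]
  refine (((Ideal.ofList zs).stableFiltration_stable (⊤ : Submodule R M)).isEventuallyBinomial
    zs.toFinset hspan hfin).mono ?_
  have := zs.toFinset_card_le
  rw [hlen, List.length_replicate] at this
  omega

end Dimension

/-! ### Hilbert coefficients of the parameter ideal. -/

section Coefficients

variable {R : Type*} [CommRing R]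

/-- Both sides equal `I + (I + J) ^ (n + 1)`. This carries the Hilbert function of the regular
sequence on `R / I` over to the changed parameters. -/
theorem Ideal.sup_pow_succ_eq_of_sup_eq {I J K : Ideal R} (h : I ⊔ J = I ⊔ K) (n : ℕ) :
    I ⊔ J ^ (n + 1) = I ⊔ K ^ (n + 1) := by
  have key (J : Ideal R) : I ⊔ J ^ (n + 1) = I ⊔ (I ⊔ J) ^ (n + 1) := by
    refine le_antisymm (sup_le_sup le_rfl (Ideal.pow_right_mono le_sup_right _)) ?_
    refine sup_le le_sup_left ((Ideal.sup_pow_succ_le I J n).trans ?_)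
    exact sup_le_sup Ideal.mul_le_left le_rfl
  rw [key J, h, ← key K]

/-- Quotients of `R / I` by extended ideals. -/
noncomputable def Ideal.quotientSMulTopEquiv (I J : Ideal R) :
    ((R ⧸ I) ⧸ J • (⊤ : Submodule R (R ⧸ I))) ≃ₗ[R] R ⧸ (I ⊔ J) :=
  Submodule.quotEquivOfEq _ _ (by
    have h : Submodule.map (Submodule.mkQ I) (J • ⊤) = J • (⊤ : Submodule R (R ⧸ I)) := by
      rw [Submodule.map_smul'', Submodule.map_top, Submodule.range_mkQ]
    rw [← h, smul_eq_mul, Ideal.mul_top]) ≪≫ₗ Submodule.quotientQuotientEquivQuotientSup I J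

/-- The length of the image of `I` in `R / J` is at most that of `I / J I`. -/
theorem Ideal.length_map_mkQ_le (I J : Ideal R) :
    Module.length R (Submodule.map J.mkQ (I ⊔ J)) ≤
      Module.length R (I ⧸ J • (⊤ : Submodule R I)) := by
  have e1 : Submodule.map J.mkQ (I ⊔ J) = LinearMap.range (J.mkQ ∘ₗ Submodule.subtype I) := by
    rw [LinearMap.range_comp, Submodule.range_subtype, Submodule.map_sup,
      Submodule.mkQ_map_self, sup_bot_eq]
  rw [e1, ← (LinearMap.quotKerEquivRange _).length_eq]
  refine Submodule.length_quotient_anti ?_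
  rw [Submodule.smul_le]
  intro a ha x _
  exact (Submodule.Quotient.mk_eq_zero J).mpr (J.mul_mem_right (x : R) ha)

variable [IsLocalRing R] [IsNoetherianRing R]

open RingTheory.Sequence in
/-- Members of a regular sequence of length `dim R` on `R / I` can be changed modulo `I` to
generate a parameter ideal of `R`. -/
theorem exists_parameter_list_of_isRegular_quotient {d : ℕ} (hdim : ringKrullDim R = d)
    {I : Ideal R} {rs : List R} (hrs : IsRegular (R ⧸ I) rs) (hlen : rs.length = d) :
    ∃ ys : List R, ys.length = d ∧ I ⊔ Ideal.ofList ys = I ⊔ Ideal.ofList rs ∧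
      ringKrullDim (R ⧸ Ideal.ofList ys) ≤ 0 := by
  obtain ⟨ys, h1, h2, h3⟩ := exists_list_ringKrullDim_quotient_le_zero I ⊥ rs
    (by rw [hlen, ← hdim]; exact ringKrullDim_quotient_le ⊥) fun l₁ l₂ h ↦ by
      -- Each initial segment is regular on `R / I`, so it lowers the dimension by its length.
      have hreg : IsRegular (R ⧸ I) l₁ := by
        refine ⟨((isWeaklyRegular_append_iff _ l₁ l₂).mp (h ▸ hrs.toIsWeaklyRegular)).1, ?_⟩
        intro htop
        refine hrs.top_ne_smul (le_antisymm (htop.le.trans (Submodule.smul_mono_left ?_)) le_top)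
        rw [h, Ideal.ofList_append]
        exact le_sup_left
      have hd := Module.supportDim_add_length_eq_supportDim_of_isRegular l₁ hreg
      have hle : Module.supportDim R (R ⧸ I) ≤ ((l₁.length + l₂.length : ℕ) : WithBot ℕ∞) := by
        rw [← List.length_append, ← h, hlen, ← hdim]
        exact Module.supportDim_le_ringKrullDim R (R ⧸ I)
      rw [← hd, Module.supportDim_eq_of_equiv (Ideal.quotientSMulTopEquiv I _),
        Module.supportDim_quotient_eq_ringKrullDim] at hle
      rw [sup_bot_eq]
      generalize ringKrullDim (R ⧸ I ⊔ Ideal.ofList l₁) = a at hle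
      induction a using WithBot.recBotCoe with
      | bot => exact bot_le
      | coe a =>
        induction a using ENat.recTopCoe with
        | top => exact absurd hle (by
            rw [not_le]
            exact_mod_cast ENat.natCast_lt_top _)
        | coe a =>
          have : a + l₁.length ≤ l₁.length + l₂.length := by exact_mod_cast hle
          have : a ≤ l₂.length := by omega
          exact_mod_cast this
  exact ⟨ys, h1.trans hlen, h2, by rwa [bot_sup_eq] at h3⟩

/-- If `R / I` is Cohen–Macaulay of dimension `dim R` and `dim I ≤ dim R - 2`, then the first
Hilbert coefficient of some parameter ideal vanishes. -/
theorem exists_parameterIdeal_hilbertCoefficient_eq_zero {d : ℕ} (hd : 0 < d)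
    (hdim : ringKrullDim R = d) {I : Ideal R} {rs : List R}
    (hmem : ∀ r ∈ rs, r ∈ maximalIdeal R)
    (hrs : RingTheory.Sequence.IsRegular (R ⧸ I) rs) (hlen : rs.length = d)
    (hI : I = ⊥ ∨ ∃ r : ℕ, d = r + 2 ∧ Module.supportDim R I ≤ (r : WithBot ℕ∞)) :
    ∃ Q : Ideal R, IsParameterIdeal Q ∧ ∃ e : ℕ → ℤ, IsHilbertCoefficients Q d e ∧ e 1 = 0 := by
  classical
  obtain ⟨ys, hys, hsup, hysdim⟩ := exists_parameter_list_of_isRegular_quotient hdim hrs hlen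
  set Q := Ideal.ofList ys with hQ
  have hIm : I ≤ maximalIdeal R := by
    refine le_maximalIdeal fun h ↦ ?_
    have := hrs.nontrivial
    exact (Ideal.Quotient.nontrivial_iff.mp this) h
  have hQm : Q ≤ maximalIdeal R := by
    have : Ideal.ofList rs ≤ maximalIdeal R := Ideal.span_le.mpr hmem
    exact le_sup_right.trans (hsup.le.trans (sup_le hIm this))
  have hQrad : Q.radical = maximalIdeal R := by
    refine le_antisymm ?_ (maximalIdeal_le_radical_of_ringKrullDim_quotient_le_zero hysdim)
    exact ((inferInstance : (maximalIdeal R).IsPrime).radical_le_iff).mpr hQm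
  obtain ⟨k, hk⟩ := exists_maximalIdeal_pow_le hysdim
  have hfin (n : ℕ) : Module.length R (R ⧸ Q ^ n) ≠ ⊤ := by
    refine length_quotient_ne_top (k := k * n) ?_
    rw [pow_mul, smul_eq_mul, Ideal.mul_top]
    exact Ideal.pow_right_mono hk n
  let ℓ : ℕ → ℤ := fun n ↦ ((Module.length R (R ⧸ Q ^ (n + 1))).toNat : ℤ)
  let e₀ : ℕ := (Module.length R (R ⧸ (I ⊔ Q))).toNat
  let h : ℕ → ℤ := fun n ↦ ((Module.length R (Submodule.map (Q ^ (n + 1)).mkQ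
    (I ⊔ Q ^ (n + 1)))).toNat : ℤ)
  have hlenI (n : ℕ) : Module.length R (R ⧸ (I ⊔ Q ^ (n + 1))) =
      ((n + d).choose d : ℕ) * Module.length R (R ⧸ (I ⊔ Q)) := by
    rw [Ideal.sup_pow_succ_eq_of_sup_eq hsup n, hsup,
      ← (Ideal.quotientSMulTopEquiv I (Ideal.ofList rs ^ (n + 1))).length_eq,
      ← (Ideal.quotientSMulTopEquiv I (Ideal.ofList rs)).length_eq, ← hlen]
    exact hrs.toIsWeaklyRegular.length_quotient_pow_smul_top hmem n
  have hdecomp (n : ℕ) : Module.length R (R ⧸ Q ^ (n + 1)) = Module.length R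
      (Submodule.map (Q ^ (n + 1)).mkQ (I ⊔ Q ^ (n + 1))) +
      Module.length R (R ⧸ (I ⊔ Q ^ (n + 1))) :=
    Submodule.length_quotient_eq_add_length_map le_sup_right
  have hfin_map (n : ℕ) : Module.length R
      (Submodule.map (Q ^ (n + 1)).mkQ (I ⊔ Q ^ (n + 1))) ≠ ⊤ := fun htop ↦
    hfin (n + 1) (by rw [hdecomp, htop, top_add])
  have hfin_sup (n : ℕ) : Module.length R (R ⧸ (I ⊔ Q ^ (n + 1))) ≠ ⊤ := fun htop ↦
    hfin (n + 1) (by rw [hdecomp, htop, add_top])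
  have hℓ (n : ℕ) : ℓ n = h n + e₀ * (((n + d).choose d : ℕ) : ℤ) := by
    have h1 := congrArg ENat.toNat (hdecomp n)
    rw [ENat.toNat_add (hfin_map n) (hfin_sup n), hlenI, ENat.toNat_mul, ENat.toNat_natCast] at h1
    simp only [ℓ, h, e₀, h1]
    push_cast
    ring
  have hℓpoly : IsEventuallyBinomial (d + 1) ℓ := by
    have hspan : Q = Ideal.span (ys.toFinset : Set R) := by
      simp [hQ, Ideal.ofList, List.coe_toFinset]
    have hNeq (n : ℕ) : (Q.stableFiltration (⊤ : Submodule R R)).shift.N n = Q ^ (n + 1) := by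
      change Q ^ (n + 1) • (⊤ : Ideal R) = Q ^ (n + 1)
      rw [smul_eq_mul, Ideal.mul_top]
    have h1 := ((Q.stableFiltration_stable (⊤ : Submodule R R)).shift).isEventuallyBinomial
      ys.toFinset hspan (fun n ↦ by rw [hNeq]; exact hfin (n + 1))
    have h2 : (fun n ↦ ((Module.length R
        (R ⧸ (Q.stableFiltration (⊤ : Submodule R R)).shift.N n)).toNat : ℤ)) = ℓ :=
      funext fun n ↦ by rw [hNeq]
    rw [h2] at h1
    exact h1.mono (Nat.succ_le_succ (hys ▸ ys.toFinset_card_le))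
  have hhpoly : IsEventuallyBinomial (d + 1) h := by
    have h1 := hℓpoly.sub_choose e₀
    have h2 : (fun n ↦ ℓ n - e₀ * (((n + d).choose d : ℕ) : ℤ)) = h := by
      funext n
      rw [hℓ]
      ring
    rwa [h2] at h1
  have hhsmall : IsEventuallyBinomial (d - 1) h := by
    rcases hI with rfl | ⟨r, rfl, hr⟩
    · refine .of_eventually_eq_zero (Filter.Eventually.of_forall fun n ↦ ?_)
      have : Submodule.map (Q ^ (n + 1)).mkQ (⊥ ⊔ Q ^ (n + 1)) = ⊥ := by
        rw [bot_sup_eq, Submodule.mkQ_map_self]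
      simp only [h]
      rw [this]
      simp
    · obtain ⟨q, hqm, hqfin, hq⟩ := exists_isEventuallyBinomial_of_supportDim_le hr
      obtain ⟨K, hK, hbound⟩ := hq.exists_le_pow
      -- The ideal `q` is adapted to `I`, so `ℓ(I / q ^ n I)` has degree at most `r`. From `𝔪 ^ k ≤
      -- Q` follows `q ^ ((k + 1) (n + 1)) ≤ Q ^ (n + 1)`; using `k + 1` keeps the exponent
      -- unbounded when `k = 0`. The factor `k + 2` comes from `(k + 1) (n + 1) + 1 ≤ (k + 2) (n +
      -- 1)`.
      have hbound' : ∀ᶠ n : ℕ in Filter.atTop,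
          |h n| ≤ (K * ((k : ℤ) + 2) ^ r) * ((n : ℤ) + 1) ^ r := by
        have htend : Filter.Tendsto (fun n : ℕ ↦ (k + 1) * (n + 1)) Filter.atTop Filter.atTop :=
          Filter.tendsto_atTop_mono (fun n ↦ n.le_succ.trans (Nat.le_mul_of_pos_left _ k.succ_pos))
            Filter.tendsto_id
        filter_upwards [htend.eventually hbound] with n hn
        have hqQ : q ^ ((k + 1) * (n + 1)) ≤ Q ^ (n + 1) := by
          rw [pow_mul]
          refine Ideal.pow_right_mono ((Ideal.pow_right_mono hqm _).trans ?_) _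
          exact (Ideal.pow_le_pow_right k.le_succ).trans hk
        have hle : h n ≤ ((Module.length R
            (I ⧸ q ^ ((k + 1) * (n + 1)) • (⊤ : Submodule R I))).toNat : ℤ) := by
          exact Int.ofNat_le.mpr <| ENat.toNat_le_toNat ((Ideal.length_map_mkQ_le I (Q ^ (n + 1))).trans
            (Submodule.length_quotient_anti (Submodule.smul_mono_left hqQ))) (hqfin _)
        rw [abs_of_nonneg (Int.natCast_nonneg _)] at hn ⊢
        refine (hle.trans hn).trans ?_
        rw [mul_assoc, ← mul_pow]
        refine mul_le_mul_of_nonneg_left (pow_le_pow_left₀ (by positivity) ?_ r) hK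
        push_cast
        nlinarith [Int.natCast_nonneg n]
      -- Each use of `of_le_pow` removes one top term; going from degree `r + 2` to `r` takes two.
      have hbound'' : ∀ᶠ n : ℕ in Filter.atTop,
          |h n| ≤ (K * ((k : ℤ) + 2) ^ r) * ((n : ℤ) + 1) ^ (r + 1) := by
        filter_upwards [hbound'] with n hn
        refine hn.trans (mul_le_mul_of_nonneg_left ?_ (by positivity))
        exact pow_le_pow_right₀ (by linarith [Int.natCast_nonneg n]) r.le_succ
      exact (hhpoly.of_le_pow hbound'').of_le_pow hbound'
  refine ⟨Q, ⟨d, fun i ↦ ys.get (i.cast hys.symm), hdim, ?_, hQrad⟩, ?_⟩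
  · rw [hQ, Ideal.ofList]
    congr 1
    ext x
    rw [Set.mem_ofPred_eq, List.mem_iff_get, Set.mem_range]
    exact ⟨fun ⟨i, hi⟩ ↦ ⟨i.cast hys, hi⟩, fun ⟨i, hi⟩ ↦ ⟨_, hi⟩⟩
  · obtain ⟨d, rfl⟩ : ∃ m, d = m + 1 := ⟨d - 1, by omega⟩
    obtain ⟨c, hc⟩ := hhsmall
    -- The dimension is now `d + 1`: `h` fills the degrees below `d`, degree `d` is empty, and `e₀`
    -- sits on top. Thus `e 1 = -u d = 0`.
    let u : ℕ → ℤ := fun j ↦ if j = d + 1 then e₀ else if j = d then 0 else c j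
    refine ⟨fun i ↦ (-1) ^ i * u (d + 1 - i), ?_, by simp [u]⟩
    filter_upwards [hc] with n hn
    refine ⟨(Module.length R (R ⧸ Q ^ (n + 1))).toNat, (ENat.natCast_toNat (hfin (n + 1))).symm, ?_⟩
    have h1 : ∀ i ∈ Finset.range (d + 1 + 1), (-1 : ℤ) ^ i * ((-1) ^ i * u (d + 1 - i)) *
        (((n + (d + 1) - i).choose (d + 1 - i) : ℕ) : ℤ) =
        (fun j ↦ u j * (((n + j).choose j : ℕ) : ℤ)) (d + 1 - i) := fun i hi ↦ by
      have hi' : i ≤ d + 1 := Nat.lt_succ_iff.mp (Finset.mem_range.mp hi)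
      have hsq : (-1 : ℤ) ^ i * (-1) ^ i = 1 := by rw [← mul_pow]; simp
      rw [← mul_assoc, hsq, one_mul, Nat.add_sub_assoc hi']
    rw [Finset.sum_congr rfl h1,
      Finset.sum_flip (fun j ↦ u j * (((n + j).choose j : ℕ) : ℤ)),
      Finset.sum_range_succ, Finset.sum_range_succ]
    have h2 : ∑ j ∈ Finset.range d, u j * (((n + j).choose j : ℕ) : ℤ) = h n := by
      rw [hn]
      refine Finset.sum_congr rfl fun j hj ↦ ?_
      have := Finset.mem_range.mp hj
      simp only [u]
      rw [if_neg (by omega), if_neg (by omega)]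
    have h3 : u d = 0 := by simp [u]
    have h4 : u (d + 1) = e₀ := by simp [u]
    rw [h2, h3, h4, zero_mul, add_zero]
    exact hℓ n

end Coefficients

/-! ### Dimension and depth along the filtration. -/

section SequentiallyCohenMacaulay

variable {R : Type*} [CommRing R]

/-- A chain of primes all in the support of `M` bounds the dimension of `M` from below. -/
theorem LTSeries.length_le_supportDim {M : Type*} [AddCommGroup M] [Module R M]
    [Module.Finite R M] (p : LTSeries (PrimeSpectrum R))
    (h : Module.annihilator R M ≤ p.head.asIdeal) :
    (p.length : WithBot ℕ∞) ≤ Module.supportDim R M := by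
  rw [Module.supportDim_eq_ringKrullDim_quotient_annihilator]
  exact p.length_le_ringKrullDim_quotient h

/-- If the bottom prime of a chain of length `d` does not contain `I`, it contains the annihilator
of `I`, whose product with `I` is zero. The chain would then force `dim I ≥ d`. -/
theorem le_ringKrullDim_quotient_of_supportDim_lt [IsNoetherianRing R] {d : ℕ}
    (hdim : ringKrullDim R = d) {I : Ideal R} (hI : Module.supportDim R I < d) :
    (d : WithBot ℕ∞) ≤ ringKrullDim (R ⧸ I) := by
  obtain ⟨p, hp⟩ := Order.le_krullDim_iff.mp hdim.ge
  by_cases h : I ≤ p.head.asIdeal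
  · exact hp ▸ p.length_le_ringKrullDim_quotient h
  · refine absurd (hp ▸ p.length_le_supportDim (M := I) fun a ha ↦ ?_) hI.not_ge
    obtain ⟨x, hx, hxp⟩ := SetLike.not_le_iff_exists.mp h
    have h0 : a * x = 0 := congrArg Subtype.val (Module.mem_annihilator.mp ha ⟨x, hx⟩)
    exact (p.head.isPrime.mem_or_mem (h0 ▸ zero_mem _ : a * x ∈ p.head.asIdeal)).resolve_right hxp

/-- The dimension of a finite module is attained at an associated prime. -/
theorem exists_mem_associatedPrimes_ringKrullDim_quotient_eq [IsNoetherianRing R] {M : Type*}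
    [AddCommGroup M] [Module R M] [Module.Finite R M] {n : ℕ}
    (h : Module.supportDim R M = n) :
    ∃ p ∈ associatedPrimes R M, ringKrullDim (R ⧸ p) = n := by
  obtain ⟨s, hs⟩ := Order.le_krullDim_iff.mp h.ge
  let s' : LTSeries (PrimeSpectrum R) := s.map Subtype.val fun _ _ h ↦ h
  have hann : Module.annihilator R M ≤ s'.head.asIdeal :=
    Module.mem_support_iff_of_finite.mp s.head.2
  obtain ⟨p, hp, hps⟩ := Ideal.exists_minimalPrimes_le hann
  refine ⟨p, Module.associatedPrimes.minimalPrimes_annihilator_subset_associatedPrimes R M hp,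
    le_antisymm ?_ ?_⟩
  · rw [← h, Module.supportDim_eq_ringKrullDim_quotient_annihilator]
    exact ringKrullDim_quotient_anti hp.1.2
  · rw [← hs]
    exact s'.length_le_ringKrullDim_quotient hps

/-- The last quotient of a filtration of `R`. -/
noncomputable def Ideal.submoduleOfTopQuotientEquiv (I : Ideal R) {T : Ideal R} (hT : T = ⊤) :
    (T ⧸ Submodule.submoduleOf I T) ≃ₗ[R] R ⧸ I :=
  Submodule.Quotient.equiv _ _ (LinearEquiv.ofTop T hT) (by
    subst hT
    ext x
    simp [Submodule.submoduleOf])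

variable [IsLocalRing R]

theorem exists_isRegular_of_lt_moduleDepth {M : Type*} [AddCommGroup M] [Module R M] {n : ℕ∞}
    (h : n < moduleDepth R M) :
    ∃ rs : List R, (∀ r ∈ rs, r ∈ maximalIdeal R) ∧ RingTheory.Sequence.IsRegular M rs ∧
      n < rs.length := by
  obtain ⟨rs, h⟩ := lt_iSup_iff.mp h
  obtain ⟨hrs, h⟩ := lt_iSup_iff.mp h
  exact ⟨rs, hrs.1, hrs.2, h⟩

theorem length_le_moduleDepth {M : Type*} [AddCommGroup M] [Module R M] {rs : List R}
    (hmem : ∀ r ∈ rs, r ∈ maximalIdeal R) (hrs : RingTheory.Sequence.IsRegular M rs) :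
    (rs.length : ℕ∞) ≤ moduleDepth R M :=
  le_iSup₂_of_le rs ⟨hmem, hrs⟩ le_rfl

/-- A Cohen–Macaulay module of dimension `d` has a regular sequence of length `d`. -/
theorem IsCohenMacaulayModule.exists_isRegular {M : Type*} [AddCommGroup M] [Module R M]
    [Nontrivial M] (h : IsCohenMacaulayModule R M) {d : ℕ} (hd : 0 < d)
    (hdim : Module.supportDim R M = d) :
    ∃ rs : List R, (∀ r ∈ rs, r ∈ maximalIdeal R) ∧ RingTheory.Sequence.IsRegular M rs ∧
      rs.length = d := by
  have hdepth : moduleDepth R M = d := by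
    have := (h.2.resolve_left (not_subsingleton M)).trans hdim
    exact_mod_cast this
  -- The depth is a supremum; a sequence longer than `d - 1` attains it.
  obtain ⟨rs, hmem, hrs, hlt⟩ := exists_isRegular_of_lt_moduleDepth (R := R) (M := M)
    (n := ((d - 1 : ℕ) : ℕ∞)) (by rw [hdepth]; exact_mod_cast Nat.sub_lt hd one_pos)
  have hle := length_le_moduleDepth hmem hrs
  rw [hdepth] at hle
  have h1 : d - 1 < rs.length := by exact_mod_cast hlt
  have h2 : rs.length ≤ d := by exact_mod_cast hle
  exact ⟨rs, hmem, hrs, by omega⟩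

end SequentiallyCohenMacaulay

/-! ### The theorem, from the top layer of the filtration. -/

theorem corollary3p15 (A : Type*) [CommRing A] [IsLocalRing A] [IsNoetherianRing A]
    (d : ℕ) (hd : 0 < d) (hdim : ringKrullDim A = d)
    (hA : IsSequentiallyCohenMacaulayRing A)
    (hAss : ∀ p ∈ associatedPrimes A A, ringKrullDim (A ⧸ p) ≠ ((d - 1 : ℕ) : WithBot ℕ∞)) :
    IsVasconcelosRing A := by
  obtain ⟨t, N, ht, -, htop, hN⟩ := hA
  obtain ⟨i, rfl⟩ : ∃ i, t = i + 1 := ⟨t - 1, by omega⟩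
  obtain ⟨hlt, hsupp, hCM⟩ := hN i i.lt_succ_self
  set I : Ideal A := N i
  have hIlt : Module.supportDim A I < d := by
    have h1 : Module.supportDim A (N (i + 1)) = d := by
      rw [Module.supportDim_eq_of_equiv (LinearEquiv.ofTop _ htop),
        Module.supportDim_self_eq_ringKrullDim, hdim]
    exact h1 ▸ hsupp
  let e := Ideal.submoduleOfTopQuotientEquiv I htop
  have hItop : I ≠ ⊤ := (hlt.trans_eq htop).ne
  have : Nontrivial (A ⧸ I) := Ideal.Quotient.nontrivial_iff.mpr hItop
  have := e.toEquiv.nontrivial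
  have hCdim : Module.supportDim A (N (i + 1) ⧸ Submodule.submoduleOf I (N (i + 1))) = d := by
    rw [Module.supportDim_eq_of_equiv e]
    refine le_antisymm (hdim ▸ Module.supportDim_le_ringKrullDim A (A ⧸ I)) ?_
    rw [Module.supportDim_quotient_eq_ringKrullDim]
    exact le_ringKrullDim_quotient_of_supportDim_lt hdim hIlt
  obtain ⟨rs, hmem, hrs, hlen⟩ := hCM.exists_isRegular hd hCdim
  refine Or.inr ⟨d, hd, hdim, exists_parameterIdeal_hilbertCoefficient_eq_zero hd hdim hmem
    ((e.isRegular_congr rs).mp hrs) hlen ?_⟩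
  by_cases hI : I = ⊥
  · exact Or.inl hI
  right
  have : Nontrivial I := Submodule.nontrivial_iff_ne_bot.mpr hI
  obtain ⟨k, hk⟩ : ∃ k : ℕ, Module.supportDim A I = k := by
    have h0 := Module.supportDim_ne_bot_of_nontrivial A I
    generalize Module.supportDim A I = a at h0 hIlt
    induction a using WithBot.recBotCoe with
    | bot => exact absurd rfl h0
    | coe a =>
      induction a using ENat.recTopCoe with
      | top => exact absurd hIlt (not_lt.mpr (by exact_mod_cast le_top))
      | coe a => exact ⟨a, rfl⟩
  have hkd : k < d := by
    rw [hk] at hIlt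
    exact_mod_cast hIlt
  -- An associated prime of `I` is one of `A`, so the hypothesis excludes dimension `d - 1`. With `k
  -- < d` this also forces `d ≥ 2`, so `d - 2` below is a true subtraction.
  have hkne : k ≠ d - 1 := by
    rintro rfl
    obtain ⟨p, hp, hpdim⟩ := exists_mem_associatedPrimes_ringKrullDim_quotient_eq hk
    exact hAss p (associatedPrimes.subset_of_injective (Submodule.subtype_injective I) hp) hpdim
  refine ⟨d - 2, by omega, ?_⟩
  rw [hk]
  have : k ≤ d - 2 := by omega
  exact_mod_cast this
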